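/- Let $d\ge 1$ and let $\nu$ be a symmetric Lévy measure on $\mathbb{R}^d$, i.e. $\int (1\wedge|y|^2)\,\nu(dy)<\infty$ and $\nu(-D)=\nu(D)$ for all Borel sets $D$. Let $\{P_t\}_{t\ge0}$ be the convolution semigroup of probability measures on $\mathbb{R}^d$ with $\int e^{i\langle\xi,y\rangle}P_t(dy)=\exp\bigl(-t\int(1-\cos\langle\xi,y\rangle)\,\nu(dy)\bigr)$, and assume that $P_t$ has a transition density $p_t:\mathbb{R}^d\to[0,\infty]$ with respect to Lebesgue measure for every $t>0$, in the version that satisfies $p_{s+t}(x)=\int p_s(x-y)p_t(y)\,dy$ for all $s,t>0$ and all $x\in\mathbb{R}^d$ (this version always exists and is unique). (1) If, for some $r_0>0$, the support of $\nu$ is contained in the closed ball of radius $r_0$ centred at $0$, then, with $m_0=\int|y|^2\,\nu(dy)$, for all $t>0$ and $x\in\mathbb{R}^d$ with $|x|\ge\frac{2em_0}{r_0}\,t$, $$p_t(x)\le \exp\left(-\frac{|x|}{4r_0}\log\left(\frac{r_0|x|}{2tm_0}\right)\right)p_t(0).$$ (2) If there are constants $M_5,M_6>0$ such that $\int|y|^2e^{|\xi||y|}\,\nu(dy)\le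 M_5$ for all $\xi\in\mathbb{R}^d$ with $|\xi|\le M_6$ (whether or not the support of $\nu$ is bounded), then for all $t>0$ and $x\in\mathbb{R}^d$ with $|x|\le 2M_5M_6t$, $$p_t(x)\le e^{-|x|^2/(4tM_5)}\,p_t(0).$$ -/

import Mathlib

open MeasureTheory
open scoped ENNReal Pointwise

/-- A Lévy measure on `ℝᵈ`: `∫ (1 ∧ |y|²) ν(dy) < ∞`. (A possible atom at the origin is immaterial,
since every integrand below vanishes there.) -/
def IsLevyMeasure {d : ℕ} (ν : Measure (EuclideanSpace ℝ (Fin d))) : Prop :=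
  ∫⁻ y, ENNReal.ofReal (min 1 (‖y‖ ^ 2)) ∂ν < ∞

/-- Symmetry of a measure: `ν(-D) = ν(D)` for every Borel set `D`. -/
def IsSymmetricMeasure {d : ℕ} (ν : Measure (EuclideanSpace ℝ (Fin d))) : Prop :=
  ∀ D : Set (EuclideanSpace ℝ (Fin d)), MeasurableSet D → ν (-D) = ν D

/-- The Lévy–Khintchine exponent `Φ(ξ) = ∫ (1 - cos⟨ξ, y⟩) ν(dy)`; the integrand is integrable
whenever `ν` is a Lévy measure. -/
noncomputable def levyExponent {d : ℕ} (ν : Measure (EuclideanSpace ℝ (Fin d)))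
    (ξ : EuclideanSpace ℝ (Fin d)) : ℝ :=
  ∫ y, (1 - Real.cos (inner ℝ ξ y)) ∂ν

/-- `P` is the convolution semigroup generated by `ν`: for each `t ≥ 0`, `P t` is the (unique)
probability measure with Fourier transform `∫ e^{i⟨ξ, y⟩} P_t(dy) = e^{-t Φ(ξ)}`. -/
structure IsLevySemigroup {d : ℕ} (ν : Measure (EuclideanSpace ℝ (Fin d)))
    (P : ℝ → Measure (EuclideanSpace ℝ (Fin d))) : Prop where
  isProbabilityMeasure : ∀ t : ℝ, 0 ≤ t → IsProbabilityMeasure (P t)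
  charFun_eq : ∀ t : ℝ, 0 ≤ t → ∀ ξ : EuclideanSpace ℝ (Fin d),
    charFun (P t) ξ = Complex.exp (-((t * levyExponent ν ξ : ℝ) : ℂ))

/-- `p` is the transition density of the convolution semigroup `P`: `p t` is a density of `P t` with
respect to Lebesgue measure for every `t > 0`, and `p` satisfies the Chapman–Kolmogorov equation
(the semigroup property) at every point. The latter only selects the version of the densities,
without which the value `p t 0` would be meaningless: whenever all `P t`, `t > 0`, have densities
`q t`, the functions `p t x = ∫ q (t/2) (x - y) * q (t/2) y dy` are densities with this property,
and they are the only ones. Values in `[0, ∞]` are needed, because `p t 0` may be infinite. -/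
structure IsTransitionDensity {d : ℕ} (P : ℝ → Measure (EuclideanSpace ℝ (Fin d)))
    (p : ℝ → EuclideanSpace ℝ (Fin d) → ℝ≥0∞) : Prop where
  measurable : ∀ t : ℝ, 0 < t → Measurable (p t)
  eq_withDensity : ∀ t : ℝ, 0 < t → P t = (volume : Measure _).withDensity (p t)
  chapman_kolmogorov : ∀ s t : ℝ, 0 < s → 0 < t → ∀ x : EuclideanSpace ℝ (Fin d),
    p (s + t) x = ∫⁻ y, p s (x - y) * p t y

/-! Fourier inversion gives `p t x` as `(2π)^(-d)` times the integral of `e^{i⟨x,ξ⟩} e^{-tΦ(ξ)}`.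
When an exponential moment of `|y|²ν(dy)` is finite, `Φ` extends analytically to a tube, and the
integral may be moved from `ξ` to `ξ + iη`. The first factor then has modulus `e^{-⟨x,η⟩}`, while
`Re Φ(ξ + iη) ≥ Φ(ξ) - |η|²K/2` with `K = ∫ |y|² e^{R|y|} ν(dy)` and `|η| < R`
(`levyExponent_sub_le_re_complexLevyExponent`). What remains under the integral is `e^{-tΦ(ξ)}`,
whose integral is `p t 0` up to the same constant. Hence `p t x ≤ exp(-⟨x,η⟩ + t|η|²K/2) p t 0`
(`IsTransitionDensity.le_exp_mul`), and both claims follow by choosing `η` parallel to `x`.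

Inversion must hold at every point. If `p t 0 = ∞` nothing is to be shown. Otherwise
Chapman–Kolmogorov at `0` and evenness put `p (t/2)` in `L²`, and Parseval applied to the
convolution of `p (t/2)` with itself yields both the integrability of `e^{-tΦ}` and the pointwise
formula. -/

/-! ### The `L²` Fourier transform and shifts of the integration domain -/

open scoped FourierTransform SchwartzMap in
/-- On `L¹ ∩ L²` the `L²`-Fourier transform is given by the Fourier integral. -/
theorem fourier_toLp_ae_eq {V : Type*} [NormedAddCommGroup V] [InnerProductSpace ℝ V]
    [FiniteDimensional ℝ V] [MeasurableSpace V] [BorelSpace V] {f : V → ℂ}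
    (hf : Integrable f) (hf2 : MemLp f 2) :
    (𝓕 (hf2.toLp f) : Lp ℂ 2 (volume : Measure V)) =ᵐ[volume] 𝓕 f := by
  have hcont : Continuous (𝓕 f) :=
    VectorFourier.fourierIntegral_continuous Real.continuous_fourierChar
      (by exact continuous_inner) hf
  refine ae_eq_of_integral_contDiff_smul_eq
    ((Lp.memLp _).locallyIntegrable (by norm_num)) hcont.locallyIntegrable ?_
  intro g hg hgs
  have h1 : HasCompactSupport (Complex.ofRealCLM ∘ g) := hgs.comp_left rfl
  let φ : 𝓢(V, ℂ) := h1.toSchwartzMap (Complex.ofRealCLM.contDiff.comp hg)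
  have hφ : ∀ x, φ x = (g x : ℂ) := fun x => rfl
  -- Tested against `φ`, either transform can be moved onto `φ`: by duality of tempered
  -- distributions for the `L²` one, by Fubini for the integral.
  have e1 := congrArg (fun T : 𝓢'(V, ℂ) => T φ)
    (Lp.fourier_toTemperedDistribution_eq (hf2.toLp f))
  simp only [TemperedDistribution.fourier_apply, Lp.toTemperedDistribution_apply] at e1
  have e2 : ∫ x, (𝓕 φ) x • f x = ∫ x, φ x • 𝓕 f x := by
    have := VectorFourier.integral_fourierIntegral_smul_eq_flip (L := innerₗ V)
      (μ := (volume : Measure V)) (ν := (volume : Measure V))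
      Real.continuous_fourierChar continuous_inner φ.integrable hf
    simpa [SchwartzMap.fourier_coe] using! this
  have e3 : ∫ x, (𝓕 φ) x • (hf2.toLp f) x = ∫ x, (𝓕 φ) x • f x := by
    refine integral_congr_ae ?_
    filter_upwards [hf2.coeFn_toLp] with x hx
    rw [hx]
  have e4 := e1.symm.trans (e3.trans e2)
  simpa [hφ] using e4

/-- Shifting the domain of integration into the complex domain: no decay at infinity is needed
beyond a uniform integrable bound, because the lateral terms of the Cauchy integral theorem are
translates of each other. -/
theorem integral_eq_integral_of_shift {V : Type*} [NormedAddCommGroup V] [InnerProductSpace ℝ V]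
    [FiniteDimensional ℝ V] [MeasurableSpace V] [BorelSpace V] (η : V) (G : V → ℝ → ℂ)
    (hc : ContinuousOn (fun q : V × ℝ => G q.1 q.2) (Set.univ ×ˢ Set.Icc 0 1))
    (hd : ∀ ξ, DifferentiableOn ℂ (fun z : ℂ => G (ξ + z.re • η) z.im)
      (Set.uIcc 0 1 ×ℂ Set.uIcc 0 1))
    (B : V → ℝ) (hB : Integrable B) (hGB : ∀ ξ, ∀ τ ∈ Set.Icc (0 : ℝ) 1, ‖G ξ τ‖ ≤ B ξ) :
    ∫ ξ, G ξ 0 = ∫ ξ, G ξ 1 := by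
  have hcτ : ∀ τ ∈ Set.Icc (0 : ℝ) 1, Continuous (fun ξ => G ξ τ) := by
    intro τ hτ
    have : Continuous ((fun q : V × ℝ => G q.1 q.2) ∘ fun ξ : V => (ξ, τ)) :=
      hc.comp_continuous (by fun_prop) (fun ξ => ⟨trivial, hτ⟩)
    exact this
  have hint : ∀ τ ∈ Set.Icc (0 : ℝ) 1, Integrable (fun ξ => G ξ τ) := fun τ hτ =>
    hB.mono' (hcτ τ hτ).aestronglyMeasurable (Filter.Eventually.of_forall fun ξ => hGB ξ τ hτ)
  -- the horizontal sides
  have hH : ∀ τ ∈ Set.Icc (0 : ℝ) 1,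
      Integrable (fun ξ => ∫ s in (0 : ℝ)..1, G (ξ + s • η) τ) ∧
      ∫ ξ, ∫ s in (0 : ℝ)..1, G (ξ + s • η) τ = ∫ ξ, G ξ τ := by
    intro τ hτ
    have hp : Integrable (fun q : V × ℝ => G (q.1 + q.2 • η) τ)
        ((volume : Measure V).prod (volume.restrict (Set.Ioc 0 1))) := by
      have hm : Continuous (fun q : V × ℝ => G (q.1 + q.2 • η) τ) :=
        (hcτ τ hτ).comp (by fun_prop)
      rw [integrable_prod_iff' hm.aestronglyMeasurable]
      refine ⟨Filter.Eventually.of_forall fun s => (hint τ hτ).comp_add_right (s • η), ?_⟩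
      have : ∀ s : ℝ, ∫ ξ, ‖G (ξ + s • η) τ‖ = ∫ ξ, ‖G ξ τ‖ := fun s =>
        integral_add_right_eq_self (fun ξ => ‖G ξ τ‖) (s • η)
      simp only [this]
      exact integrable_const _
    simp only [intervalIntegral.integral_of_le zero_le_one]
    refine ⟨hp.integral_prod_left, ?_⟩
    rw [integral_integral_swap hp]
    have : ∀ s : ℝ, ∫ ξ, G (ξ + s • η) τ = ∫ ξ, G ξ τ := fun s =>
      integral_add_right_eq_self (fun ξ => G ξ τ) (s • η)
    simp [this]
  -- the vertical sides
  have hV : Integrable (fun ξ => ∫ τ in (0 : ℝ)..1, G ξ τ) := by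
    have hp : Integrable (fun q : V × ℝ => G q.1 q.2)
        ((volume : Measure V).prod (volume.restrict (Set.Ioc 0 1))) := by
      have hr : ((volume : Measure V).prod (volume.restrict (Set.Ioc (0 : ℝ) 1)))
          = ((volume : Measure V).prod volume).restrict (Set.univ ×ˢ Set.Ioc 0 1) := by
        rw [← Measure.prod_restrict, Measure.restrict_univ]
      have hm : MeasurableSet ((Set.univ : Set V) ×ˢ Set.Ioc (0 : ℝ) 1) :=
        MeasurableSet.univ.prod measurableSet_Ioc
      refine (hB.comp_fst (volume.restrict (Set.Ioc (0 : ℝ) 1))).mono' ?_ ?_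
      · rw [hr]
        exact (hc.mono (Set.prod_mono le_rfl Set.Ioc_subset_Icc_self)).aestronglyMeasurable hm
      · rw [hr]
        filter_upwards [ae_restrict_mem hm] with q hq
        exact hGB q.1 q.2 (Set.Ioc_subset_Icc_self hq.2)
    simp only [intervalIntegral.integral_of_le zero_le_one]
    exact hp.integral_prod_left
  -- Cauchy's theorem on the unit square of the complex line `ξ + zη`, where `z = s + iτ`. After
  -- integration in `ξ` the two vertical sides cancel by translation invariance.
  have hrect : ∀ ξ, (∫ s in (0 : ℝ)..1, G (ξ + s • η) 0) - (∫ s in (0 : ℝ)..1, G (ξ + s • η) 1) +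
      Complex.I * (∫ τ in (0 : ℝ)..1, G (ξ + η) τ) - Complex.I * (∫ τ in (0 : ℝ)..1, G ξ τ)
      = 0 := by
    intro ξ
    have := Complex.integral_boundary_rect_eq_zero_of_differentiableOn
      (fun z : ℂ => G (ξ + z.re • η) z.im) 0 (1 + Complex.I) (by simpa using hd ξ)
    simpa using this
  have h0 := hH 0 (by simp)
  have h1 := hH 1 (by simp)
  have hV' : Integrable (fun ξ => ∫ τ in (0 : ℝ)..1, G (ξ + η) τ) := hV.comp_add_right η
  have hVe : ∫ ξ, ∫ τ in (0 : ℝ)..1, G (ξ + η) τ = ∫ ξ, ∫ τ in (0 : ℝ)..1, G ξ τ :=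
    integral_add_right_eq_self (fun ξ => ∫ τ in (0 : ℝ)..1, G ξ τ) η
  have key : ∫ ξ, ((∫ s in (0 : ℝ)..1, G (ξ + s • η) 0) - ∫ s in (0 : ℝ)..1, G (ξ + s • η) 1) =
      ∫ ξ, (Complex.I * (∫ τ in (0 : ℝ)..1, G ξ τ) -
        Complex.I * (∫ τ in (0 : ℝ)..1, G (ξ + η) τ)) :=
    integral_congr_ae (Filter.Eventually.of_forall fun ξ => by linear_combination hrect ξ)
  rw [integral_sub h0.1 h1.1, integral_sub (hV.const_mul _) (hV'.const_mul _),
    integral_const_mul, integral_const_mul, hVe, h0.2, h1.2, sub_self] at key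
  exact sub_eq_zero.mp key

/-! ### Bounds for complex sine and cosine -/

/-- Mean value inequality on the convex strip `|Im z| ≤ |Im w|`, where `|cos z| ≤ e^{|Im w|}`. -/
theorem Complex.norm_sin_le_norm_mul_exp (w : ℂ) : ‖Complex.sin w‖ ≤ ‖w‖ * Real.exp |w.im| := by
  have h := Convex.norm_image_sub_le_of_norm_hasDerivWithin_le (f := Complex.sin)
    (f' := Complex.cos) (s := {z : ℂ | |z.im| ≤ |w.im|}) (x := 0) (y := w) (C := Real.exp |w.im|)
    (fun z _ => (Complex.hasDerivAt_sin z).hasDerivWithinAt) ?_ ?_ (by simp) (by simp)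
  · simpa [mul_comm] using h
  · intro z hz
    have h1 : ‖Complex.exp (z * Complex.I)‖ ≤ Real.exp |w.im| := by
      rw [Complex.norm_exp]
      apply Real.exp_le_exp.2
      have := neg_le_abs z.im
      simp only [Set.mem_ofPred_eq] at hz
      simp
      linarith
    have h2 : ‖Complex.exp (-z * Complex.I)‖ ≤ Real.exp |w.im| := by
      rw [Complex.norm_exp]
      apply Real.exp_le_exp.2
      have := le_abs_self z.im
      simp only [Set.mem_ofPred_eq] at hz
      simp
      linarith
    rw [Complex.cos, norm_div, Complex.norm_ofNat]
    have := norm_add_le (Complex.exp (z * Complex.I)) (Complex.exp (-z * Complex.I))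
    linarith
  · have : {z : ℂ | |z.im| ≤ |w.im|} = Complex.imLm ⁻¹' (Set.Icc (-|w.im|) |w.im|) := by
      ext z; simp [abs_le]
    rw [this]
    exact (convex_Icc _ _).linear_preimage _

/-- Since `1 - cos w = 2 sin²(w/2)`, squaring the sine bound at `w/2` restores the full exponent
`|Im w|`. -/
theorem Complex.norm_one_sub_cos_le (w : ℂ) :
    ‖1 - Complex.cos w‖ ≤ ‖w‖ ^ 2 / 2 * Real.exp |w.im| := by
  have h1 : 1 - Complex.cos w = 2 * Complex.sin (w / 2) ^ 2 := by
    have h := Complex.cos_two_mul' (w / 2)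
    have h' := Complex.sin_sq_add_cos_sq (w / 2)
    rw [mul_div_cancel₀ w two_ne_zero] at h
    linear_combination -h' - h
  have h2 := Complex.norm_sin_le_norm_mul_exp (w / 2)
  have him : |(w / 2).im| = |w.im| / 2 := by
    rw [show (w / 2).im = w.im / 2 by simp [Complex.div_ofNat_im], abs_div, abs_two]
  rw [him, norm_div, Complex.norm_ofNat] at h2
  rw [h1, norm_mul, norm_pow, Complex.norm_ofNat]
  have h3 : Real.exp |w.im| = Real.exp (|w.im| / 2) ^ 2 := by
    rw [← Real.exp_nat_mul]; congr 1; push_cast; ring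
  rw [h3]
  calc 2 * ‖Complex.sin (w / 2)‖ ^ 2 ≤ 2 * (‖w‖ / 2 * Real.exp (|w.im| / 2)) ^ 2 := by gcongr
    _ = _ := by ring

theorem Real.cosh_sub_one_le (v : ℝ) : Real.cosh v - 1 ≤ v ^ 2 / 2 * Real.exp |v| := by
  have h := Complex.norm_one_sub_cos_le (v * Complex.I)
  rw [Complex.cos_mul_I, ← Complex.ofReal_cosh, norm_sub_rev] at h
  have h1 : ‖((Real.cosh v : ℝ) : ℂ) - 1‖ = Real.cosh v - 1 := by
    rw [← Complex.ofReal_one, ← Complex.ofReal_sub, Complex.norm_real, Real.norm_eq_abs, abs_of_nonneg]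
    linarith [Real.one_le_cosh v]
  rw [h1] at h
  simpa using h

/-! ### Analytic continuation of the Lévy–Khintchine exponent -/

section ComplexExponent

variable {d : ℕ} (ν : Measure (EuclideanSpace ℝ (Fin d)))

/-- The analytic continuation `Φ(ξ + iη)` of the Lévy–Khintchine exponent. -/
noncomputable def complexLevyExponent (ξ η : EuclideanSpace ℝ (Fin d)) : ℂ :=
  ∫ y, (1 - Complex.cos ((inner ℝ ξ y : ℝ) + (inner ℝ η y : ℝ) * Complex.I)) ∂ν

variable {ν}

theorem norm_one_sub_cos_inner_le (ξ η y : EuclideanSpace ℝ (Fin d)) {R : ℝ} (hR : ‖η‖ ≤ R) :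
    ‖1 - Complex.cos ((inner ℝ ξ y : ℝ) + (inner ℝ η y : ℝ) * Complex.I)‖ ≤
      (‖ξ‖ + R) ^ 2 / 2 * (‖y‖ ^ 2 * Real.exp (R * ‖y‖)) := by
  refine (Complex.norm_one_sub_cos_le _).trans ?_
  have hη : |inner ℝ η y| ≤ R * ‖y‖ :=
    (abs_real_inner_le_norm η y).trans (by gcongr)
  have h1 : ‖((inner ℝ ξ y : ℝ) : ℂ) + (inner ℝ η y : ℝ) * Complex.I‖ ≤ (‖ξ‖ + R) * ‖y‖ := by
    refine (norm_add_le _ _).trans ?_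
    rw [norm_mul, Complex.norm_I, Complex.norm_real, Complex.norm_real, mul_one, add_mul]
    exact add_le_add (abs_real_inner_le_norm ξ y) hη
  have h2 : |(((inner ℝ ξ y : ℝ) : ℂ) + (inner ℝ η y : ℝ) * Complex.I).im| ≤ R * ‖y‖ := by
    simpa using hη
  calc _ ≤ ((‖ξ‖ + R) * ‖y‖) ^ 2 / 2 * Real.exp (R * ‖y‖) := by gcongr
    _ = _ := by ring

theorem integrable_one_sub_cos_inner {R : ℝ}
    (hν : Integrable (fun y => ‖y‖ ^ 2 * Real.exp (R * ‖y‖)) ν)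
    (ξ : EuclideanSpace ℝ (Fin d)) {η : EuclideanSpace ℝ (Fin d)} (hη : ‖η‖ ≤ R) :
    Integrable (fun y =>
      1 - Complex.cos ((inner ℝ ξ y : ℝ) + (inner ℝ η y : ℝ) * Complex.I)) ν := by
  refine (hν.const_mul ((‖ξ‖ + R) ^ 2 / 2)).mono' ?_
    (Filter.Eventually.of_forall fun y => norm_one_sub_cos_inner_le ξ η y hη)
  exact Continuous.aestronglyMeasurable (by fun_prop)

theorem continuousOn_complexLevyExponent {R : ℝ}
    (hν : Integrable (fun y => ‖y‖ ^ 2 * Real.exp (R * ‖y‖)) ν) :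
    ContinuousOn (fun q : EuclideanSpace ℝ (Fin d) × EuclideanSpace ℝ (Fin d) =>
      complexLevyExponent ν q.1 q.2) (Set.univ ×ˢ Metric.closedBall 0 R) := by
  intro q₀ _
  unfold complexLevyExponent
  refine continuousWithinAt_of_dominated
    (bound := fun y => (‖q₀.1‖ + 1 + R) ^ 2 / 2 * (‖y‖ ^ 2 * Real.exp (R * ‖y‖))) ?_ ?_
    (hν.const_mul _) ?_
  · exact Filter.Eventually.of_forall fun q => Continuous.aestronglyMeasurable (by fun_prop)
  · have h1 : ∀ᶠ q : EuclideanSpace ℝ (Fin d) × EuclideanSpace ℝ (Fin d) in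
        nhdsWithin q₀ (Set.univ ×ˢ Metric.closedBall 0 R), ‖q.1‖ < ‖q₀.1‖ + 1 :=
      nhdsWithin_le_nhds ((continuous_fst.norm.tendsto q₀).eventually_lt_const (by simp))
    filter_upwards [h1, self_mem_nhdsWithin] with q hq hq2
    have hq3 : ‖q.2‖ ≤ R := by simpa using hq2.2
    have hR : 0 ≤ R := (norm_nonneg _).trans hq3
    refine Filter.Eventually.of_forall fun y => (norm_one_sub_cos_inner_le q.1 q.2 y hq3).trans ?_
    gcongr
  · exact Filter.Eventually.of_forall fun y => Continuous.continuousWithinAt (by fun_prop)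

theorem differentiableAt_complexLevyExponent {R : ℝ}
    (hν : Integrable (fun y => ‖y‖ ^ 2 * Real.exp (R * ‖y‖)) ν)
    (ξ η : EuclideanSpace ℝ (Fin d)) {z₀ : ℂ} (hz : |z₀.im| * ‖η‖ < R) :
    DifferentiableAt ℂ (fun z : ℂ => complexLevyExponent ν (ξ + z.re • η) (z.im • η)) z₀ := by
  have hrw : ∀ (z : ℂ) (y : EuclideanSpace ℝ (Fin d)),
      (((inner ℝ (ξ + z.re • η) y : ℝ) : ℂ) + (inner ℝ (z.im • η) y : ℝ) * Complex.I) =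
        (inner ℝ ξ y : ℝ) + z * (inner ℝ η y : ℝ) := by
    intro z y
    simp only [inner_add_left, real_inner_smul_left]
    push_cast
    linear_combination ((inner ℝ η y : ℝ) : ℂ) * Complex.re_add_im z
  have him : ∀ (z : ℂ) (y : EuclideanSpace ℝ (Fin d)),
      |(((inner ℝ ξ y : ℝ) : ℂ) + z * (inner ℝ η y : ℝ)).im| ≤ |z.im| * ‖η‖ * ‖y‖ := by
    intro z y
    have : (((inner ℝ ξ y : ℝ) : ℂ) + z * (inner ℝ η y : ℝ)).im = z.im * inner ℝ η y := by simp
    rw [this, abs_mul, mul_assoc]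
    gcongr
    exact abs_real_inner_le_norm η y
  -- The strict inequality makes this a neighbourhood of `z₀`, and bounding `‖z‖` gives one
  -- dominating function for the derivative.
  let s : Set ℂ := {z | |z.im| * ‖η‖ < R ∧ ‖z‖ < ‖z₀‖ + 1}
  have hs : s ∈ nhds z₀ := by
    refine IsOpen.mem_nhds ?_ ⟨hz, by simp⟩
    exact (isOpen_lt (Complex.continuous_im.abs.mul_const ‖η‖) continuous_const).inter
      (isOpen_lt continuous_norm continuous_const)
  have hb : ‖z₀.im • η‖ ≤ R := by rw [norm_smul, Real.norm_eq_abs]; exact hz.le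
  unfold complexLevyExponent
  simp only [hrw]
  refine (hasDerivAt_integral_of_dominated_loc_of_deriv_le (𝕜 := ℂ) (s := s)
    (F := fun z y => 1 - Complex.cos ((inner ℝ ξ y : ℝ) + z * (inner ℝ η y : ℝ)))
    (F' := fun z y => Complex.sin ((inner ℝ ξ y : ℝ) + z * (inner ℝ η y : ℝ)) * (inner ℝ η y : ℝ))
    (bound := fun y => (‖ξ‖ + (‖z₀‖ + 1) * ‖η‖) * ‖η‖ * (‖y‖ ^ 2 * Real.exp (R * ‖y‖)))
    hs ?_ ?_ ?_ ?_ (hν.const_mul _) ?_).2.differentiableAt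
  · exact Filter.Eventually.of_forall fun q => Continuous.aestronglyMeasurable (by fun_prop)
  · have := integrable_one_sub_cos_inner hν (ξ + z₀.re • η) hb
    simpa only [hrw] using this
  · exact Continuous.aestronglyMeasurable (by fun_prop)
  · refine Filter.Eventually.of_forall fun y z hzs => ?_
    have hη := abs_real_inner_le_norm η y
    have h1 : ‖((inner ℝ ξ y : ℝ) : ℂ) + z * (inner ℝ η y : ℝ)‖ ≤
        (‖ξ‖ + (‖z₀‖ + 1) * ‖η‖) * ‖y‖ := by
      refine (norm_add_le _ _).trans ?_
      rw [norm_mul, Complex.norm_real, Complex.norm_real, add_mul, mul_assoc]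
      refine add_le_add (abs_real_inner_le_norm ξ y) ?_
      exact mul_le_mul hzs.2.le hη (norm_nonneg _) (by positivity)
    have h2 := (him z y).trans (mul_le_mul_of_nonneg_right hzs.1.le (norm_nonneg y))
    rw [norm_mul, Complex.norm_real]
    calc _ ≤ ‖((inner ℝ ξ y : ℝ) : ℂ) + z * (inner ℝ η y : ℝ)‖ *
          Real.exp |(((inner ℝ ξ y : ℝ) : ℂ) + z * (inner ℝ η y : ℝ)).im| * (‖η‖ * ‖y‖) := by
          gcongr
          · exact Complex.norm_sin_le_norm_mul_exp _
          · exact hη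
      _ ≤ (‖ξ‖ + (‖z₀‖ + 1) * ‖η‖) * ‖y‖ * Real.exp (R * ‖y‖) * (‖η‖ * ‖y‖) := by gcongr
      _ = _ := by ring
  · refine Filter.Eventually.of_forall fun y z _ => ?_
    have h1 : HasDerivAt (fun z : ℂ => ((inner ℝ ξ y : ℝ) : ℂ) + z * (inner ℝ η y : ℝ))
        (inner ℝ η y : ℝ) z := by
      simpa using ((hasDerivAt_id z).mul_const ((inner ℝ η y : ℝ) : ℂ)).const_add
        ((inner ℝ ξ y : ℝ) : ℂ)
    have h2 := h1.ccos.const_sub 1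
    simpa using h2

theorem integrable_one_sub_cos {R : ℝ} (hR : 0 ≤ R)
    (hν : Integrable (fun y => ‖y‖ ^ 2 * Real.exp (R * ‖y‖)) ν)
    (ξ : EuclideanSpace ℝ (Fin d)) :
    Integrable (fun y => 1 - Real.cos (inner ℝ ξ y)) ν := by
  have h := (integrable_one_sub_cos_inner hν ξ (η := 0) (by simpa using hR)).re
  refine h.congr (Filter.Eventually.of_forall fun y => ?_)
  simp [← Complex.ofReal_cos]

theorem complexLevyExponent_zero_right (ξ : EuclideanSpace ℝ (Fin d)) :
    complexLevyExponent ν ξ 0 = levyExponent ν ξ := by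
  rw [complexLevyExponent, levyExponent, ← integral_complex_ofReal]
  congr 1; ext y; simp

/-- With `u = ⟨ξ,y⟩` and `v = ⟨η,y⟩`, the real part of the integrand is `1 - cos u cosh v = (1 - cos
u) - (cosh v - 1) + (cosh v - 1)(1 - cos u)`. The last term is nonnegative, and `cosh v - 1 ≤ (v²/2)
e^{|v|}`. -/
theorem levyExponent_sub_le_re_complexLevyExponent {R : ℝ}
    (hν : Integrable (fun y => ‖y‖ ^ 2 * Real.exp (R * ‖y‖)) ν)
    (ξ : EuclideanSpace ℝ (Fin d)) {η : EuclideanSpace ℝ (Fin d)} (hη : ‖η‖ ≤ R) :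
    levyExponent ν ξ - ‖η‖ ^ 2 / 2 * ∫ y, ‖y‖ ^ 2 * Real.exp (R * ‖y‖) ∂ν ≤
      (complexLevyExponent ν ξ η).re := by
  have hR : 0 ≤ R := (norm_nonneg η).trans hη
  have hi := integrable_one_sub_cos_inner hν ξ hη
  have hre : (complexLevyExponent ν ξ η).re = ∫ y, (1 - Complex.cos ((inner ℝ ξ y : ℝ) +
      (inner ℝ η y : ℝ) * Complex.I)).re ∂ν := (integral_re hi).symm
  rw [hre, levyExponent, ← integral_const_mul,
    ← integral_sub (integrable_one_sub_cos hR hν ξ) (hν.const_mul _)]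
  refine integral_mono ((integrable_one_sub_cos hR hν ξ).sub (hν.const_mul _)) hi.re fun y => ?_
  set u : ℝ := inner ℝ ξ y
  set v : ℝ := inner ℝ η y
  have h1 : (1 - Complex.cos (u + v * Complex.I)).re = 1 - Real.cos u * Real.cosh v := by
    rw [Complex.cos_add_mul_I]
    simp [← Complex.ofReal_cos, ← Complex.ofReal_cosh, ← Complex.ofReal_sin, ← Complex.ofReal_sinh]
  have hv : |v| ≤ ‖η‖ * ‖y‖ := abs_real_inner_le_norm η y
  have h2 := Real.cosh_sub_one_le v
  have h3 : v ^ 2 / 2 * Real.exp |v| ≤ ‖η‖ ^ 2 / 2 * (‖y‖ ^ 2 * Real.exp (R * ‖y‖)) := by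
    rw [← sq_abs]
    calc _ ≤ (‖η‖ * ‖y‖) ^ 2 / 2 * Real.exp (R * ‖y‖) := by
          gcongr
          exact hv.trans (by gcongr)
      _ = _ := by ring
  have h4 : 0 ≤ (Real.cosh v - 1) * (1 - Real.cos u) :=
    mul_nonneg (by linarith [Real.one_le_cosh v]) (by linarith [Real.cos_le_one u])
  change 1 - Real.cos u - ‖η‖ ^ 2 / 2 * (‖y‖ ^ 2 * Real.exp (R * ‖y‖)) ≤
    (1 - Complex.cos (u + v * Complex.I)).re
  rw [h1]
  nlinarith

end ComplexExponent

/-! ### Parseval's identity and pointwise Fourier inversion -/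

open scoped FourierTransform ComplexConjugate in
/-- Parseval's identity on `L¹ ∩ L²`. -/
theorem integral_conj_mul_eq_fourier {V : Type*} [NormedAddCommGroup V] [InnerProductSpace ℝ V]
    [FiniteDimensional ℝ V] [MeasurableSpace V] [BorelSpace V] {f g : V → ℂ}
    (hf : Integrable f) (hf2 : MemLp f 2) (hg : Integrable g) (hg2 : MemLp g 2) :
    Integrable (fun ξ => conj (𝓕 g ξ) * 𝓕 f ξ) ∧
      ∫ ξ, conj (𝓕 g ξ) * 𝓕 f ξ = ∫ y, conj (g y) * f y := by
  have h := Lp.inner_fourier_eq (hg2.toLp g) (hf2.toLp f)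
  have hi := L2.integrable_inner (𝕜 := ℂ) (𝓕 (hg2.toLp g) : Lp ℂ 2 (volume : Measure V))
    (𝓕 (hf2.toLp f))
  rw [L2.inner_def, L2.inner_def] at h
  have e1 : (fun ξ => inner ℂ ((𝓕 (hg2.toLp g) : Lp ℂ 2 (volume : Measure V)) ξ)
      ((𝓕 (hf2.toLp f) : Lp ℂ 2 (volume : Measure V)) ξ)) =ᵐ[volume]
      fun ξ => conj (𝓕 g ξ) * 𝓕 f ξ := by
    filter_upwards [fourier_toLp_ae_eq hf hf2, fourier_toLp_ae_eq hg hg2] with ξ h1 h2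
    rw [h1, h2, RCLike.inner_apply, mul_comm]
  have e2 : (fun y => inner ℂ (hg2.toLp g y) (hf2.toLp f y)) =ᵐ[volume]
      fun y => conj (g y) * f y := by
    filter_upwards [hf2.coeFn_toLp, hg2.coeFn_toLp] with ξ h1 h2
    rw [h1, h2, RCLike.inner_apply, mul_comm]
  rw [integral_congr_ae e1, integral_congr_ae e2] at h
  exact ⟨hi.congr e1, h⟩

section Density

variable {d : ℕ} {ν : Measure (EuclideanSpace ℝ (Fin d))}
  {P : ℝ → Measure (EuclideanSpace ℝ (Fin d))}
  {p : ℝ → EuclideanSpace ℝ (Fin d) → ℝ≥0∞}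

theorem levyExponent_neg (ν : Measure (EuclideanSpace ℝ (Fin d)))
    (ξ : EuclideanSpace ℝ (Fin d)) : levyExponent ν (-ξ) = levyExponent ν ξ := by
  simp [levyExponent]

/-- Cosine is even, hence so is the exponent, and characteristic functions determine the law. -/
theorem IsLevySemigroup.map_neg (hP : IsLevySemigroup ν P) {t : ℝ} (ht : 0 ≤ t) :
    (P t).map Neg.neg = P t := by
  have := hP.isProbabilityMeasure t ht
  have : IsProbabilityMeasure ((P t).map Neg.neg) :=
    Measure.isProbabilityMeasure_map measurable_neg.aemeasurable
  refine Measure.ext_of_charFun ?_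
  ext ξ
  have h : charFun ((P t).map Neg.neg) ξ = charFun (P t) (-ξ) := by
    rw [charFun_apply, charFun_apply, integral_map measurable_neg.aemeasurable
      (Continuous.aestronglyMeasurable (by fun_prop))]
    simp
  rw [h, hP.charFun_eq t ht, hP.charFun_eq t ht, levyExponent_neg]

theorem IsTransitionDensity.lintegral_eq_one (hP : IsLevySemigroup ν P)
    (hp : IsTransitionDensity P p) {t : ℝ} (ht : 0 < t) : ∫⁻ y, p t y = 1 := by
  have := hP.isProbabilityMeasure t ht.le
  have h := measure_univ (μ := P t)
  rwa [hp.eq_withDensity t ht, withDensity_apply _ MeasurableSet.univ,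
    Measure.restrict_univ] at h

theorem IsTransitionDensity.comp_neg_ae_eq (hP : IsLevySemigroup ν P)
    (hp : IsTransitionDensity P p) {t : ℝ} (ht : 0 < t) :
    (fun y => p t (-y)) =ᵐ[volume] p t := by
  have hm := hp.measurable t ht
  have h := hP.map_neg ht.le
  rw [hp.eq_withDensity t ht] at h
  refine (withDensity_eq_iff (hm.comp measurable_neg).aemeasurable hm.aemeasurable ?_).1 ?_
  · have : ∫⁻ y, p t (-y) = ∫⁻ y, p t y := lintegral_neg_eq_self (p t)
    change ∫⁻ y, p t (-y) ≠ ∞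
    rw [this, hp.lintegral_eq_one hP ht]
    exact ENNReal.one_ne_top
  · conv_rhs => rw [← h]
    ext s hs
    rw [Measure.map_apply measurable_neg hs, withDensity_apply _ hs,
      withDensity_apply _ (measurable_neg hs), ← lintegral_indicator hs,
      ← lintegral_indicator (measurable_neg hs), ← lintegral_neg_eq_self]
    congr 1
    ext y
    simp only [Set.indicator, Function.comp_apply, neg_neg]
    rfl

theorem IsTransitionDensity.integral_exp_mul (hP : IsLevySemigroup ν P)
    (hp : IsTransitionDensity P p) {t : ℝ} (ht : 0 < t) (ξ : EuclideanSpace ℝ (Fin d)) :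
    ∫ y, Complex.exp ((inner ℝ y ξ : ℝ) * Complex.I) * ((p t y).toReal : ℂ) =
      Real.exp (-(t * levyExponent ν ξ)) := by
  have h := hP.charFun_eq t ht.le ξ
  have hfin : ∀ᵐ y, p t y < ∞ := ae_lt_top (hp.measurable t ht)
    (by rw [hp.lintegral_eq_one hP ht]; exact ENNReal.one_ne_top)
  rw [charFun_apply, hp.eq_withDensity t ht,
    integral_withDensity_eq_integral_toReal_smul (hp.measurable t ht) hfin] at h
  rw [Complex.ofReal_exp, Complex.ofReal_neg, ← h]
  congr 1
  ext y
  rw [Complex.real_smul, mul_comm]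

open scoped FourierTransform in
theorem IsTransitionDensity.fourier_toReal_sub (hP : IsLevySemigroup ν P)
    (hp : IsTransitionDensity P p) {t : ℝ} (ht : 0 < t) (x ξ : EuclideanSpace ℝ (Fin d)) :
    𝓕 (fun y => ((p t (x - y)).toReal : ℂ)) ξ =
      Complex.exp (-((inner ℝ x ((2 * Real.pi) • ξ) : ℝ) * Complex.I)) *
        Real.exp (-(t * levyExponent ν ((2 * Real.pi) • ξ))) := by
  rw [← hp.integral_exp_mul hP ht, ← integral_const_mul, Real.fourier_eq',
    ← integral_sub_left_eq_self _ volume x]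
  congr 1
  ext y
  rw [sub_sub_cancel, smul_eq_mul, ← mul_assoc, ← Complex.exp_add]
  congr 2
  simp only [inner_sub_left, real_inner_smul_right]
  push_cast
  ring

open scoped FourierTransform in
theorem IsTransitionDensity.fourier_toReal (hP : IsLevySemigroup ν P)
    (hp : IsTransitionDensity P p) {t : ℝ} (ht : 0 < t) (ξ : EuclideanSpace ℝ (Fin d)) :
    𝓕 (fun y => ((p t y).toReal : ℂ)) ξ =
      Real.exp (-(t * levyExponent ν ((2 * Real.pi) • ξ))) := by
  rw [← levyExponent_neg, ← hp.integral_exp_mul hP ht, Real.fourier_eq']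
  congr 1
  ext y
  rw [smul_eq_mul]
  congr 2
  simp only [inner_neg_right, real_inner_smul_right]
  push_cast
  ring

open scoped FourierTransform ComplexConjugate in
/-- Fourier inversion for the transition density, at every point. -/
theorem IsTransitionDensity.eq_ofReal_integral (hP : IsLevySemigroup ν P)
    (hp : IsTransitionDensity P p) {t : ℝ} (ht : 0 < t) (h0 : p t 0 ≠ ∞) :
    Integrable (fun ξ => Real.exp (-(t * levyExponent ν ξ))) ∧
    ∀ x, ∃ r : ℝ, 0 ≤ r ∧ p t x = ENNReal.ofReal r ∧
      (r : ℂ) = (((2 * Real.pi) ^ d)⁻¹ : ℝ) • ∫ ξ, Complex.exp ((inner ℝ x ξ : ℝ) * Complex.I) *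
        Real.exp (-(t * levyExponent ν ξ)) := by
  have hs : 0 < t / 2 := half_pos ht
  set q := p (t / 2) with hq
  have hqm : Measurable q := hp.measurable _ hs
  have hq1 : ∫⁻ y, q y = 1 := hp.lintegral_eq_one hP hs
  have hfin : ∀ᵐ y, q y < ∞ := ae_lt_top hqm (by rw [hq1]; exact ENNReal.one_ne_top)
  have hconv : ∀ x, p t x = ∫⁻ y, q (x - y) * q y := fun x => by
    have := hp.chapman_kolmogorov (t / 2) (t / 2) hs hs x
    rwa [add_halves] at this
  have hfi : Integrable (fun y => ((q y).toReal : ℂ)) :=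
    (integrable_toReal_of_lintegral_ne_top hqm.aemeasurable
      (by rw [hq1]; exact ENNReal.one_ne_top)).ofReal
  -- By evenness, Chapman–Kolmogorov at `0` reads `p t 0 = ∫ q²`, which is finite by `h0`.
  have hf2 : MemLp (fun y => ((q y).toReal : ℂ)) 2 := by
    rw [memLp_two_iff_integrable_sq_norm hfi.aestronglyMeasurable]
    have : (fun y => ‖((q y).toReal : ℂ)‖ ^ 2) = fun y => (q y * q y).toReal := by
      ext y
      rw [Complex.norm_real, Real.norm_eq_abs, sq_abs, ENNReal.toReal_mul, sq]
    rw [this]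
    refine integrable_toReal_of_lintegral_ne_top (hqm.mul hqm).aemeasurable ?_
    have h1 : ∫⁻ y, q y * q y = p t 0 := by
      rw [hconv 0]
      refine lintegral_congr_ae ?_
      filter_upwards [hp.comp_neg_ae_eq hP hs] with y hy
      rw [zero_sub]
      exact congrArg (· * q y) hy.symm
    rwa [h1]
  have hmp : ∀ x, MeasurePreserving (fun y : EuclideanSpace ℝ (Fin d) => x - y) := fun x =>
    Measure.measurePreserving_sub_left volume x
  have hgi : ∀ x, Integrable (fun y => ((q (x - y)).toReal : ℂ)) := fun x => hfi.comp_sub_left x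
  have hg2 : ∀ x, MemLp (fun y => ((q (x - y)).toReal : ℂ)) 2 := fun x =>
    hf2.comp_measurePreserving (hmp x)
  -- Pairing `q` with `q (x - ·)` gives the convolution `p t x` on one side and the inversion
  -- integral on the other.
  have hpars := fun x => integral_conj_mul_eq_fourier hfi hf2 (hgi x) (hg2 x)
  have hF : ∀ x ξ, conj (𝓕 (fun y => ((q (x - y)).toReal : ℂ)) ξ) *
      𝓕 (fun y => ((q y).toReal : ℂ)) ξ =
      Complex.exp ((inner ℝ x ((2 * Real.pi) • ξ) : ℝ) * Complex.I) *
        Real.exp (-(t * levyExponent ν ((2 * Real.pi) • ξ))) := by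
    intro x ξ
    rw [hp.fourier_toReal_sub hP hs, hp.fourier_toReal hP hs, map_mul, Complex.conj_ofReal,
      ← Complex.exp_conj, mul_assoc, ← Complex.ofReal_mul, ← Real.exp_add]
    congr 2
    · simp
    · congr 1; ring
  simp only [hF] at hpars
  -- The Fourier kernel is `e^{-2πi⟨y,ξ⟩}`; the dilation by `2π` produces the factor `(2π)^(-d)`.
  have hpi : (2 * Real.pi) ≠ 0 := by positivity
  constructor
  · have h1 := (hpars 0).1.re
    refine (integrable_comp_smul_iff volume
      (fun ξ => Real.exp (-(t * levyExponent ν ξ))) hpi).1 ?_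
    refine h1.congr (Filter.Eventually.of_forall fun ξ => ?_)
    simp [-Complex.ofReal_exp]
  · intro x
    have hprod : Integrable (fun y => (q (x - y)).toReal * (q y).toReal) := by
      have := ((hg2 x).re.integrable_mul hf2.re)
      simpa using! this
    have hnn : ∀ y, 0 ≤ (q (x - y)).toReal * (q y).toReal := fun y => by positivity
    refine ⟨∫ y, (q (x - y)).toReal * (q y).toReal, integral_nonneg hnn, ?_, ?_⟩
    · rw [ofReal_integral_eq_lintegral_ofReal hprod (Filter.Eventually.of_forall hnn), hconv x]
      refine lintegral_congr_ae ?_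
      filter_upwards [hfin, (hmp x).quasiMeasurePreserving.ae hfin] with y h1 h2
      rw [ENNReal.ofReal_mul ENNReal.toReal_nonneg, ENNReal.ofReal_toReal h1.ne,
        ENNReal.ofReal_toReal h2.ne]
    · have h1 := (hpars x).2
      rw [Measure.integral_comp_smul volume (fun ξ =>
        Complex.exp ((inner ℝ x ξ : ℝ) * Complex.I) * Real.exp (-(t * levyExponent ν ξ)))] at h1
      rw [finrank_euclideanSpace_fin, abs_of_nonneg (by positivity)] at h1
      rw [h1, ← integral_complex_ofReal]
      simp

end Density

/-! ### The exponential bound and the choice of the shift -/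

section ExponentialBound

variable {d : ℕ} {ν : Measure (EuclideanSpace ℝ (Fin d))}
  {P : ℝ → Measure (EuclideanSpace ℝ (Fin d))}
  {p : ℝ → EuclideanSpace ℝ (Fin d) → ℝ≥0∞}

theorem norm_exp_complexLevyExponent_le {R : ℝ}
    (hν : Integrable (fun y => ‖y‖ ^ 2 * Real.exp (R * ‖y‖)) ν) {t : ℝ} (ht : 0 ≤ t)
    (x ξ η : EuclideanSpace ℝ (Fin d)) (hη : ‖η‖ ≤ R) :
    ‖Complex.exp (((inner ℝ x ξ : ℝ) + (inner ℝ x η : ℝ) * Complex.I) * Complex.I) *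
      Complex.exp (-(t * complexLevyExponent ν ξ η))‖ ≤
    Real.exp (-inner ℝ x η + t * (‖η‖ ^ 2 / 2 * ∫ y, ‖y‖ ^ 2 * Real.exp (R * ‖y‖) ∂ν)) *
      Real.exp (-(t * levyExponent ν ξ)) := by
  rw [norm_mul, Complex.norm_exp, Complex.norm_exp, ← Real.exp_add, ← Real.exp_add]
  apply Real.exp_le_exp.2
  have h := mul_le_mul_of_nonneg_left (levyExponent_sub_le_re_complexLevyExponent hν ξ hη) ht
  simp
  linarith

/-- The Fourier inversion integral, shifted into the complex domain by `iη`. -/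
theorem integral_exp_levyExponent_eq_shift {R : ℝ}
    (hν : Integrable (fun y => ‖y‖ ^ 2 * Real.exp (R * ‖y‖)) ν) {t : ℝ} (ht : 0 ≤ t)
    (hint : Integrable (fun ξ => Real.exp (-(t * levyExponent ν ξ))))
    (x η : EuclideanSpace ℝ (Fin d)) (hη : ‖η‖ < R) :
    ∫ ξ, Complex.exp ((inner ℝ x ξ : ℝ) * Complex.I) * Real.exp (-(t * levyExponent ν ξ)) =
      ∫ ξ, Complex.exp (((inner ℝ x ξ : ℝ) + (inner ℝ x η : ℝ) * Complex.I) * Complex.I) *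
        Complex.exp (-(t * complexLevyExponent ν ξ η)) := by
  obtain ⟨K, hK⟩ : ∃ K, K = ∫ y, ‖y‖ ^ 2 * Real.exp (R * ‖y‖) ∂ν := ⟨_, rfl⟩
  have hK0 : 0 ≤ K := hK ▸ integral_nonneg fun y => by positivity
  have hτ : ∀ τ ∈ Set.Icc (0 : ℝ) 1, ‖τ • η‖ ≤ ‖η‖ := fun τ hτ => by
    rw [norm_smul, Real.norm_eq_abs, abs_of_nonneg hτ.1]
    exact mul_le_of_le_one_left (norm_nonneg _) hτ.2
  have hshift := integral_eq_integral_of_shift η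
    (fun ξ τ =>
      Complex.exp (((inner ℝ x ξ : ℝ) + (inner ℝ x (τ • η) : ℝ) * Complex.I) * Complex.I) *
        Complex.exp (-(t * complexLevyExponent ν ξ (τ • η)))) ?_ ?_
    (fun ξ => Real.exp (‖x‖ * ‖η‖ + t * (‖η‖ ^ 2 / 2 * K)) *
      Real.exp (-(t * levyExponent ν ξ))) (hint.const_mul _) ?_
  · simpa [complexLevyExponent_zero_right] using hshift
  · have h1 : ContinuousOn (fun q : EuclideanSpace ℝ (Fin d) × ℝ =>
        complexLevyExponent ν q.1 (q.2 • η)) (Set.univ ×ˢ Set.Icc 0 1) := by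
      refine (continuousOn_complexLevyExponent hν).comp
        (f := fun q : EuclideanSpace ℝ (Fin d) × ℝ => (q.1, q.2 • η))
        (Continuous.continuousOn (by fun_prop)) ?_
      intro q hq
      exact ⟨trivial, by simpa using (hτ q.2 hq.2).trans hη.le⟩
    have h2 : Continuous (fun q : EuclideanSpace ℝ (Fin d) × ℝ =>
        Complex.exp (((inner ℝ x q.1 : ℝ) + (inner ℝ x (q.2 • η) : ℝ) * Complex.I) *
          Complex.I)) := by fun_prop
    exact h2.continuousOn.mul (continuousOn_const.mul h1).neg.cexp
  · intro ξ z hz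
    have hz1 : z.im ∈ Set.Icc (0 : ℝ) 1 := by
      have := hz.2
      rwa [Set.uIcc_of_le (zero_le_one' ℝ)] at this
    have h1 : |z.im| * ‖η‖ < R := by
      have := hτ _ hz1
      rw [norm_smul, Real.norm_eq_abs] at this
      exact this.trans_lt hη
    have h2 := differentiableAt_complexLevyExponent hν ξ η h1
    have h3 : ∀ z : ℂ, ((inner ℝ x (ξ + z.re • η) : ℝ) +
        (inner ℝ x (z.im • η) : ℝ) * Complex.I : ℂ) =
        (inner ℝ x ξ : ℝ) + z * (inner ℝ x η : ℝ) := by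
      intro z
      simp only [inner_add_right, real_inner_smul_right]
      push_cast
      linear_combination ((inner ℝ x η : ℝ) : ℂ) * Complex.re_add_im z
    simp only [h3]
    have h4 : DifferentiableAt ℂ (fun z : ℂ =>
        Complex.exp (((inner ℝ x ξ : ℝ) + z * (inner ℝ x η : ℝ)) * Complex.I)) z := by fun_prop
    exact (h4.mul (h2.const_mul _).neg.cexp).differentiableWithinAt
  · intro ξ τ hτ'
    have h1 := hτ τ hτ'
    refine (norm_exp_complexLevyExponent_le hν ht x ξ (τ • η) (h1.trans hη.le)).trans ?_
    rw [← hK]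
    have h2 : -inner ℝ x (τ • η) ≤ ‖x‖ * ‖η‖ :=
      (neg_le_abs _).trans ((abs_real_inner_le_norm _ _).trans (by gcongr))
    gcongr

/-- The analytic bound obtained by shifting the Fourier inversion integral by `iη`. -/
theorem IsTransitionDensity.le_exp_mul (hP : IsLevySemigroup ν P)
    (hp : IsTransitionDensity P p) {R : ℝ}
    (hν : Integrable (fun y => ‖y‖ ^ 2 * Real.exp (R * ‖y‖)) ν) {t : ℝ} (ht : 0 < t)
    (x η : EuclideanSpace ℝ (Fin d)) (hη : ‖η‖ < R) :
    p t x ≤ ENNReal.ofReal (Real.exp (-inner ℝ x η +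
      t * (‖η‖ ^ 2 / 2 * ∫ y, ‖y‖ ^ 2 * Real.exp (R * ‖y‖) ∂ν))) * p t 0 := by
  by_cases h0 : p t 0 = ∞
  · rw [h0, ENNReal.mul_top]
    · exact le_top
    · exact (ENNReal.ofReal_pos.2 (Real.exp_pos _)).ne'
  obtain ⟨hint, hinv⟩ := hp.eq_ofReal_integral hP ht h0
  obtain ⟨r₀, hr₀, hp₀, he₀⟩ := hinv 0
  obtain ⟨r, hr, hpx, he⟩ := hinv x
  have hr₀' : r₀ = ((2 * Real.pi) ^ d)⁻¹ * ∫ ξ, Real.exp (-(t * levyExponent ν ξ)) := by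
    have : ∀ ξ : EuclideanSpace ℝ (Fin d), Complex.exp ((inner ℝ 0 ξ : ℝ) * Complex.I) *
      Real.exp (-(t * levyExponent ν ξ)) = (Real.exp (-(t * levyExponent ν ξ)) : ℝ) := by simp
    simp only [this] at he₀
    rw [integral_complex_ofReal, Complex.real_smul] at he₀
    exact_mod_cast he₀
  rw [hpx, hp₀, ← ENNReal.ofReal_mul (Real.exp_pos _).le]
  apply ENNReal.ofReal_le_ofReal
  have hrn : r = ‖(r : ℂ)‖ := by rw [Complex.norm_real, Real.norm_eq_abs, abs_of_nonneg hr]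
  have hpi : 0 ≤ ((2 * Real.pi) ^ d)⁻¹ := by positivity
  rw [hrn, he, integral_exp_levyExponent_eq_shift hν ht.le hint x η hη, norm_smul, Real.norm_eq_abs, abs_of_nonneg hpi, hr₀', mul_left_comm]
  refine mul_le_mul_of_nonneg_left ?_ hpi
  rw [← integral_const_mul]
  exact norm_integral_le_of_norm_le (hint.const_mul _) (Filter.Eventually.of_forall fun ξ =>
    norm_exp_complexLevyExponent_le hν ht.le x ξ η hη.le)

theorem integrable_and_integral_le_of_lintegral_le {α : Type*} [MeasurableSpace α] {μ : Measure α}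
    {f : α → ℝ} (hf : AEStronglyMeasurable f μ) (h0 : ∀ y, 0 ≤ f y) {M : ℝ} (hM : 0 ≤ M)
    (h : ∫⁻ y, ENNReal.ofReal (f y) ∂μ ≤ ENNReal.ofReal M) :
    Integrable f μ ∧ ∫ y, f y ∂μ ≤ M := by
  constructor
  · refine ⟨hf, ?_⟩
    rw [hasFiniteIntegral_iff_ofReal (Filter.Eventually.of_forall h0)]
    exact h.trans_lt ENNReal.ofReal_lt_top
  · rw [integral_eq_lintegral_of_nonneg_ae (Filter.Eventually.of_forall h0) hf]
    exact ENNReal.toReal_le_of_le_ofReal hM h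

theorem IsTransitionDensity.le_gaussian_mul (hd : 1 ≤ d) (hP : IsLevySemigroup ν P)
    (hp : IsTransitionDensity P p) {M₅ M₆ : ℝ} (h5 : 0 < M₅) (h6 : 0 < M₆)
    (hM : ∀ ξ : EuclideanSpace ℝ (Fin d), ‖ξ‖ ≤ M₆ →
      ∫⁻ y, ENNReal.ofReal (‖y‖ ^ 2 * Real.exp (‖ξ‖ * ‖y‖)) ∂ν ≤ ENNReal.ofReal M₅)
    {t : ℝ} (ht : 0 < t) (x : EuclideanSpace ℝ (Fin d)) (hx : ‖x‖ ≤ 2 * M₅ * M₆ * t) :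
    p t x ≤ ENNReal.ofReal (Real.exp (-‖x‖ ^ 2 / (4 * t * M₅))) * p t 0 := by
  -- Positive dimension supplies a vector of norm exactly `M₆`, so the moment bound is available
  -- with `R = M₆`.
  have : Nonempty (Fin d) := ⟨⟨0, hd⟩⟩
  obtain ⟨e, he⟩ := exists_norm_eq (EuclideanSpace ℝ (Fin d)) h6.le
  have h := hM e he.le
  rw [he] at h
  obtain ⟨hi, hK⟩ := integrable_and_integral_le_of_lintegral_le
    (Continuous.aestronglyMeasurable (by fun_prop)) (fun y => by positivity) h5.le h
  -- For `η = c x/(M₅ t)` the exponent is at most `(-c + c²/2)|x|²/(M₅ t)`. The value `c = 1/2`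
  -- could reach `|η| = M₆`; `c = 3/8` keeps `|η| ≤ 3M₆/4` and gives `-39/128 ≤ -1/4`.
  have hη : ‖(3 / (8 * M₅ * t)) • x‖ = 3 / (8 * M₅ * t) * ‖x‖ := by
    rw [norm_smul, Real.norm_eq_abs, abs_of_nonneg (by positivity)]
  have hlt : ‖(3 / (8 * M₅ * t)) • x‖ < M₆ := by
    rw [hη]
    calc 3 / (8 * M₅ * t) * ‖x‖ ≤ 3 / (8 * M₅ * t) * (2 * M₅ * M₆ * t) := by gcongr
      _ = 3 / 4 * M₆ := by field_simp; ring
      _ < M₆ := by linarith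
  refine (hp.le_exp_mul hP hi ht x _ hlt).trans ?_
  refine mul_le_mul_left (ENNReal.ofReal_le_ofReal (Real.exp_le_exp.2 ?_)) _
  rw [hη, real_inner_smul_right, real_inner_self_eq_norm_sq]
  calc _ ≤ -(3 / (8 * M₅ * t) * ‖x‖ ^ 2) + t * ((3 / (8 * M₅ * t) * ‖x‖) ^ 2 / 2 * M₅) := by
        gcongr
    _ = -(39 / 128 * (‖x‖ ^ 2 / (t * M₅))) := by field_simp; ring
    _ ≤ -(1 / 4 * (‖x‖ ^ 2 / (t * M₅))) := by
        have : 0 ≤ ‖x‖ ^ 2 / (t * M₅) := by positivity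
        linarith
    _ = _ := by field_simp

theorem IsLevyMeasure.integrable_sq_mul_exp (hν : IsLevyMeasure ν) {r₀ : ℝ} (hr : 0 < r₀)
    (hball : ∀ᵐ y ∂ν, ‖y‖ ≤ r₀) {R : ℝ} (hR : 0 ≤ R) :
    Integrable (fun y => ‖y‖ ^ 2 * Real.exp (R * ‖y‖)) ν := by
  have h1 : Integrable (fun y : EuclideanSpace ℝ (Fin d) => min 1 (‖y‖ ^ 2)) ν := by
    refine ⟨Continuous.aestronglyMeasurable (by fun_prop), ?_⟩
    rw [hasFiniteIntegral_iff_ofReal (Filter.Eventually.of_forall fun y => by positivity)]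
    exact hν
  refine (h1.const_mul ((1 + r₀ ^ 2) * Real.exp (R * r₀))).mono'
    (Continuous.aestronglyMeasurable (by fun_prop)) ?_
  filter_upwards [hball] with y hy
  rw [Real.norm_eq_abs, abs_of_nonneg (by positivity)]
  have h2 : ‖y‖ ^ 2 ≤ (1 + r₀ ^ 2) * min 1 (‖y‖ ^ 2) := by
    have : ‖y‖ ^ 2 ≤ r₀ ^ 2 := by gcongr
    rcases min_cases (1 : ℝ) (‖y‖ ^ 2) with ⟨h, _⟩ | ⟨h, _⟩ <;> rw [h] <;> nlinarith [sq_nonneg ‖y‖]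
  calc _ ≤ (1 + r₀ ^ 2) * min 1 (‖y‖ ^ 2) * Real.exp (R * r₀) := by gcongr
    _ = _ := by ring

theorem IsTransitionDensity.le_of_support_subset (hν : IsLevyMeasure ν)
    (hP : IsLevySemigroup ν P) (hp : IsTransitionDensity P p) {r₀ : ℝ} (hr : 0 < r₀)
    (hsupp : ν.support ⊆ Metric.closedBall 0 r₀) {t : ℝ} (ht : 0 < t)
    (x : EuclideanSpace ℝ (Fin d))
    (hx : 2 * Real.exp 1 * (∫ y, ‖y‖ ^ 2 ∂ν) / r₀ * t ≤ ‖x‖) :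
    p t x ≤ ENNReal.ofReal (Real.exp (-‖x‖ / (4 * r₀) *
      Real.log (r₀ * ‖x‖ / (2 * t * ∫ y, ‖y‖ ^ 2 ∂ν)))) * p t 0 := by
  have hball : ∀ᵐ y ∂ν, ‖y‖ ≤ r₀ := by
    filter_upwards [Measure.support_mem_ae (μ := ν)] with y hy
    simpa using hsupp hy
  have hm0 : 0 ≤ ∫ y, ‖y‖ ^ 2 ∂ν := integral_nonneg fun y => by positivity
  have hmi : Integrable (fun y => ‖y‖ ^ 2) ν := by
    simpa using hν.integrable_sq_mul_exp hr hball le_rfl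
  -- If `m₀ = 0`, division by zero turns the logarithm into `log 0 = 0`; the claim is `p t x ≤ p t
  -- 0`, the case `η = 0`.
  rcases hm0.eq_or_lt with hm | hm
  · have h := hp.le_exp_mul hP (hν.integrable_sq_mul_exp hr hball zero_le_one) ht x 0 (by simp)
    simpa [← hm] using h
  generalize hme : ∫ y, ‖y‖ ^ 2 ∂ν = m at *
  set L := Real.log (r₀ * ‖x‖ / (2 * t * m)) with hL
  have hx0 : 0 < ‖x‖ := lt_of_lt_of_le (by positivity) hx
  have hratio : Real.exp 1 ≤ r₀ * ‖x‖ / (2 * t * m) := by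
    rw [le_div_iff₀ (by positivity)]
    calc Real.exp 1 * (2 * t * m) = r₀ * (2 * Real.exp 1 * m / r₀ * t) := by field_simp
      _ ≤ r₀ * ‖x‖ := by gcongr
  have hL1 : 1 ≤ L := (Real.le_log_iff_exp_le (by positivity)).2 hratio
  have hexpL : Real.exp L = r₀ * ‖x‖ / (2 * t * m) := Real.exp_log (by positivity)
  -- With `|η| = L/(2r₀)` the linear term is twice the desired exponent, so half of it may be spent
  -- on the quadratic term. The radius `R = 3L/(4r₀)` exceeds `|η|`, yet `e^{Rr₀} = e^{3L/4}` stays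
  -- below `e^L`, leaving a factor `e^{-L/4}` to absorb the extra power of `L`.
  have hη : ‖(L / (2 * r₀ * ‖x‖)) • x‖ = L / (2 * r₀) := by
    rw [norm_smul, Real.norm_eq_abs, abs_of_nonneg (by positivity)]
    field_simp
  have hlt : ‖(L / (2 * r₀ * ‖x‖)) • x‖ < 3 * L / (4 * r₀) := by
    rw [hη, div_lt_div_iff₀ (by positivity) (by positivity)]
    have : 0 < L * r₀ := by positivity
    nlinarith
  have hi := hν.integrable_sq_mul_exp hr hball (R := 3 * L / (4 * r₀)) (by positivity)
  refine (hp.le_exp_mul hP hi ht x _ hlt).trans ?_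
  refine mul_le_mul_left (ENNReal.ofReal_le_ofReal (Real.exp_le_exp.2 ?_)) _
  have hK : ∫ y, ‖y‖ ^ 2 * Real.exp (3 * L / (4 * r₀) * ‖y‖) ∂ν ≤ m * Real.exp (3 * L / 4) := by
    rw [← hme, ← integral_mul_const]
    refine integral_mono_ae hi (hmi.mul_const _) ?_
    filter_upwards [hball] with y hy
    have : 3 * L / (4 * r₀) * ‖y‖ ≤ 3 * L / 4 := by
      calc 3 * L / (4 * r₀) * ‖y‖ ≤ 3 * L / (4 * r₀) * r₀ := by gcongr
        _ = _ := by field_simp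
    change ‖y‖ ^ 2 * _ ≤ ‖y‖ ^ 2 * _
    gcongr
  have hm' : m * Real.exp (3 * L / 4) = r₀ * ‖x‖ / (2 * t) * Real.exp (-(L / 4)) := by
    have : m = r₀ * ‖x‖ / (2 * t) * Real.exp (-L) := by
      rw [Real.exp_neg, hexpL]
      field_simp
    rw [this, mul_assoc, ← Real.exp_add]
    congr 2
    ring
  have hE : L * Real.exp (-(L / 4)) ≤ 4 := by
    rw [Real.exp_neg, ← div_eq_mul_inv, div_le_iff₀ (Real.exp_pos _)]
    linarith [Real.add_one_le_exp (L / 4)]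
  rw [hη, real_inner_smul_right, real_inner_self_eq_norm_sq]
  calc _ ≤ -(L / (2 * r₀ * ‖x‖) * ‖x‖ ^ 2) +
        t * ((L / (2 * r₀)) ^ 2 / 2 * (r₀ * ‖x‖ / (2 * t) * Real.exp (-(L / 4)))) := by
        rw [← hm']
        gcongr
    _ = ‖x‖ / r₀ * L * (-(1 / 2) + L * Real.exp (-(L / 4)) / 16) := by field_simp; ring
    _ ≤ ‖x‖ / r₀ * L * (-(1 / 4)) := by
        gcongr
        linarith
    _ = _ := by field_simp

end ExponentialBound

theorem mainTheorem10 {d : ℕ} (hd : 1 ≤ d)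
    (ν : Measure (EuclideanSpace ℝ (Fin d)))
    (hν : IsLevyMeasure ν) (hsymm : IsSymmetricMeasure ν)
    (P : ℝ → Measure (EuclideanSpace ℝ (Fin d))) (hP : IsLevySemigroup ν P)
    (p : ℝ → EuclideanSpace ℝ (Fin d) → ℝ≥0∞) (hp : IsTransitionDensity P p) :
    (∀ r₀ : ℝ, 0 < r₀ → ν.support ⊆ Metric.closedBall 0 r₀ →
      ∀ m₀ : ℝ, m₀ = ∫ y, ‖y‖ ^ 2 ∂ν →
      ∀ t : ℝ, 0 < t → ∀ x : EuclideanSpace ℝ (Fin d),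
        2 * Real.exp 1 * m₀ / r₀ * t ≤ ‖x‖ →
        p t x ≤
          ENNReal.ofReal (Real.exp (-‖x‖ / (4 * r₀) * Real.log (r₀ * ‖x‖ / (2 * t * m₀)))) * p t 0) ∧
    (∀ M₅ M₆ : ℝ, 0 < M₅ → 0 < M₆ →
      (∀ ξ : EuclideanSpace ℝ (Fin d), ‖ξ‖ ≤ M₆ →
        ∫⁻ y, ENNReal.ofReal (‖y‖ ^ 2 * Real.exp (‖ξ‖ * ‖y‖)) ∂ν ≤ ENNReal.ofReal M₅) →
      ∀ t : ℝ, 0 < t → ∀ x : EuclideanSpace ℝ (Fin d),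
        ‖x‖ ≤ 2 * M₅ * M₆ * t →
        p t x ≤ ENNReal.ofReal (Real.exp (-‖x‖ ^ 2 / (4 * t * M₅))) * p t 0) := by
  refine ⟨fun r₀ hr hsupp m₀ hm t ht x hx => ?_, fun M₅ M₆ h5 h6 hM t ht x hx =>
    hp.le_gaussian_mul hd hP h5 h6 hM ht x hx⟩
  subst hm
  exact hp.le_of_support_subset hν hP hr hsupp ht x hx
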